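/- Let $\mathbf H=\{z=x+iy : y>0\}$ be the hyperbolic plane with volume form $\mu=y^{-2}\,dx\,dy$, and let $u(z,w)=\cosh d(z,w)=1+\frac{|z-w|^2}{2\,\Im z\,\Im w}$, where $d$ is the hyperbolic distance. Let $\Gamma\subset\mathrm{SL}_2(\mathbf R)$ be a cofinite Fuchsian group, i.e. a discrete subgroup such that $\Gamma\backslash\mathbf H$ has finite volume with respect to $\mu$. Equip the space of holomorphic cusp forms of weight $2$ for $\Gamma$ with the Petersson inner product $$\langle f,g\rangle=\int_{\Gamma\backslash\mathbf H} f(z)\overline{g(z)}\,y^2\,\mu(z)=\frac1{\#(\Gamma\cap\{\pm1\})}\int_D f(z)\overline{g(z)}\,y^2\,\mu(z),$$ where $D$ is any measurable fundamental domain for the action of $\Gamma/(\Gamma\cap\{\pm1\})$ on $\mathbf H$. Let $B$ be an orthonormal basis of this space and put $$F_\Gamma(z)=\sum_{f\in B}(\Im z)^2|f(z)|^2,\qquad N_\Gamma(z,b)=\#\{\gamma\in\Gamma : u(z,\gamma z)\le b\}.$$ Then for all $z\in\mathbf H$ and all real $a>1$, $$F_\Gamma(z)\le\frac{(a-1)\,N_\Gamma(z,2a^2-1)}{8\pi\bigl(\log\frac{a+1}{2}\bigr)^2}.$$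 -/

import Mathlib

open scoped MatrixGroups

namespace FuchsianBound

open UpperHalfPlane MeasureTheory

/-- The image of `Γ ⊆ SL(2, ℝ)` in `PGL(2, ℝ)`, i.e. `Γ` modulo `Γ ∩ {±1}`. This is the group of
transformations of `ℍ` induced by `Γ`. -/
abbrev projImage (Γ : Subgroup SL(2, ℝ)) : Subgroup PGL(2, ℝ) :=
  Γ.map Matrix.SpecialLinearGroup.toPGL

/-- `D` is a fundamental domain for the action of `Γ` on the hyperbolic plane, with respect to the
measure `dx dy / y ^ 2` (which is the `volume` on `ℍ`). -/
def IsFundDomain (Γ : Subgroup SL(2, ℝ)) (D : Set ℍ) : Prop :=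
  IsFundamentalDomain (projImage Γ) D (volume : Measure ℍ)

/-- A cofinite Fuchsian group: a discrete subgroup of `SL(2, ℝ)` such that `Γ \ ℍ` has finite
hyperbolic volume. -/
structure IsCofiniteFuchsian (Γ : Subgroup SL(2, ℝ)) : Prop where
  discrete : DiscreteTopology Γ
  finite_volume : ∃ D : Set ℍ, IsFundDomain Γ D ∧ volume D < ⊤

/-- The space of holomorphic cusp forms of weight 2 for `Γ`. -/
abbrev CuspForms₂ (Γ : Subgroup SL(2, ℝ)) : Type :=
  CuspForm (Γ.map Matrix.SpecialLinearGroup.toGL) 2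

open Classical in
/-- The order of the generic stabiliser `Γ ∩ {±1}`. -/
noncomputable def genericStabCard (Γ : Subgroup SL(2, ℝ)) : ℕ :=
  if (-1 : SL(2, ℝ)) ∈ Γ then 2 else 1

/-- The integral over `Γ \ ℍ` of a `Γ`-invariant function, computed on a fundamental domain `D`.
Integration is in the sense of stacks: the integral over `D` is divided by the order of
`Γ ∩ {±1}`. -/
noncomputable def quotientIntegral (Γ : Subgroup SL(2, ℝ)) (D : Set ℍ) (φ : ℍ → ℂ) : ℂ :=
  (genericStabCard Γ : ℂ)⁻¹ * ∫ z in D, φ z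

/-- The Petersson inner product: the integral over `Γ \ ℍ` of `conj (f z) * g z * (im z) ^ 2`. -/
noncomputable def peterssonInner (Γ : Subgroup SL(2, ℝ)) (D : Set ℍ) (f g : CuspForms₂ Γ) : ℂ :=
  quotientIntegral Γ D (petersson 2 f g)

/-- `B` is an orthonormal basis of the space of cusp forms of weight 2 for the Petersson inner
product. (A form that is not square-integrable would have `peterssonInner Γ D f f = 0`, so members
of `B` are square-integrable.) -/
structure IsOrthonormalBasis (Γ : Subgroup SL(2, ℝ)) (D : Set ℍ) (B : Set (CuspForms₂ Γ)) :
    Prop where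
  normalized : ∀ f ∈ B, peterssonInner Γ D f f = 1
  orthogonal : ∀ f ∈ B, ∀ g ∈ B, f ≠ g → peterssonInner Γ D f g = 0
  span_eq_top : Submodule.span ℂ B = ⊤

/-- The terms `(im z) ^ 2 * |f z| ^ 2`, for `f` in `B`. -/
noncomputable def bergmanTerm {Γ : Subgroup SL(2, ℝ)} (B : Set (CuspForms₂ Γ)) (z : ℍ) (f : B) :
    ℝ :=
  z.im ^ 2 * ‖f.1 z‖ ^ 2

/-- The function `F_Γ`, computed on an orthonormal basis `B`. -/
noncomputable def bergmanF {Γ : Subgroup SL(2, ℝ)} (B : Set (CuspForms₂ Γ)) (z : ℍ) : ℝ :=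
  ∑' f : B, bergmanTerm B z f

/-- The hyperbolic cosine of the hyperbolic distance. -/
noncomputable def u (z w : ℍ) : ℝ := Real.cosh (dist z w)

/-- The counting function `N_Γ(z, b)`; elements of `Γ` are counted in `SL(2, ℝ)`. -/
noncomputable def N (Γ : Subgroup SL(2, ℝ)) (z : ℍ) (b : ℝ) : ℕ :=
  {γ : SL(2, ℝ) | γ ∈ Γ ∧ u z (γ • z) ≤ b}.ncard

end FuchsianBound

namespace FuchsianBound

open UpperHalfPlane MeasureTheory Metric Matrix
open scoped ENNReal Real ComplexConjugate Manifold

/-! For one square-integrable form, read `f(z) dz` in the disc model centred at `z`: its coefficient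
`h` is holomorphic, and the area mean value inequality for `|h|²` bounds `4π (a-1)/(a+1) ·
y²|f(z)|²` by the integral of `y²|f|²` over the hyperbolic disc `u ≤ a`
(`enorm_sq_mul_im_sq_le_lintegral`). Unfolding over a fundamental domain costs at most the number of
translates of a point lying in that disc. Two such translates differ by an element moving `z` by at
most the diameter, whose hyperbolic cosine is `2a² - 1`; this gives `N Γ z (2a² - 1)`
(`genericStabCard_mul_lintegral_le`). To treat all of `B` at once, apply the bound to the finite
reproducing kernel `∑ conj (f z) • f`, whose value at `z` and squared norm coincide
(`sum_bergmanTerm_le`). The result `F ≤ N (a+1) / (4π (a-1))` is sharper than the stated bound,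
which follows by `log_sq_mul_le`. -/

/-! ### Mean value inequalities on Euclidean discs. -/

/-- Mean value inequality on circles, for `‖h‖ ^ 2`. -/
lemma two_pi_mul_enorm_sq_le_lintegral_circle {h : ℂ → ℂ} {R s : ℝ} (hs : 0 < s) (hsR : s < R)
    (hh : DifferentiableOn ℂ h (ball 0 R)) :
    ENNReal.ofReal (2 * π) * ‖h 0‖ₑ ^ 2 ≤
      ∫⁻ θ in Set.Ioo (-π) π, ‖h (Complex.polarCoord.symm (s, θ))‖ₑ ^ 2 := by
  have hd : DiffContOnCl ℂ (fun w ↦ h w ^ 2) (ball 0 |s|) := by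
    rw [abs_of_pos hs]
    exact (hh.pow 2).diffContOnCl_ball (closedBall_subset_ball hsR)
  have hpi : (0 : ℝ) < 2 * π := Real.two_pi_pos
  have key : h 0 ^ 2 = (2 * π)⁻¹ • ∫ θ in Set.Ioo (-π) π, h (circleMap 0 s θ) ^ 2 := by
    rw [← hd.circleAverage, Real.circleAverage_eq_integral_add (-π),
      intervalIntegral.integral_comp_add_right (fun θ ↦ h (circleMap 0 s θ) ^ 2),
      show 0 + -π = -π by ring, show 2 * π + -π = π by ring,
      intervalIntegral.integral_of_le (by linarith), integral_Ioc_eq_integral_Ioo]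
  have hsymm (θ : ℝ) : Complex.polarCoord.symm (s, θ) = circleMap 0 s θ := by
    simp [Complex.polarCoord_symm_apply, circleMap, Complex.exp_mul_I]
  have : ‖h 0‖ₑ ^ 2 ≤ ENNReal.ofReal (2 * π)⁻¹ *
      ∫⁻ θ in Set.Ioo (-π) π, ‖h (circleMap 0 s θ)‖ₑ ^ 2 := by
    rw [← enorm_pow, key, enorm_smul, Real.enorm_of_nonneg (by positivity)]
    gcongr
    refine (enorm_integral_le_lintegral_enorm _).trans_eq ?_
    simp only [enorm_pow]
  simp only [hsymm]
  calc _ ≤ ENNReal.ofReal (2 * π) * (ENNReal.ofReal (2 * π)⁻¹ *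
      ∫⁻ θ in Set.Ioo (-π) π, ‖h (circleMap 0 s θ)‖ₑ ^ 2) := by gcongr
    _ = _ := by
      rw [← mul_assoc, ← ENNReal.ofReal_mul hpi.le, mul_inv_cancel₀ hpi.ne', ENNReal.ofReal_one,
        one_mul]

/-- Lebesgue integral over a disc in polar coordinates. -/
lemma lintegral_ball_zero_eq_polar (R : ℝ) {φ : ℂ → ℝ≥0∞}
    (hφ : Measurable ((ball 0 R).indicator φ)) :
    ∫⁻ w in ball 0 R, φ w = ∫⁻ s in Set.Ioo 0 R, ENNReal.ofReal s *
      ∫⁻ θ in Set.Ioo (-π) π, φ (Complex.polarCoord.symm (s, θ)) := by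
  have hm : Measurable fun p : ℝ × ℝ ↦
      ENNReal.ofReal p.1 * (ball 0 R).indicator φ (Complex.polarCoord.symm p) := by
    refine (ENNReal.measurable_ofReal.comp measurable_fst).mul (hφ.comp ?_)
    rw [show ⇑Complex.polarCoord.symm = _ from funext Complex.polarCoord_symm_apply]
    fun_prop
  rw [← lintegral_indicator measurableSet_ball, ← Complex.lintegral_comp_polarCoord_symm]
  simp only [smul_eq_mul, polarCoord_target, Measure.volume_eq_prod]
  rw [setLIntegral_prod _ hm.aemeasurable,
    ← lintegral_indicator measurableSet_Ioo, ← lintegral_indicator measurableSet_Ioi]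
  congr 1 with s
  by_cases hs0 : 0 < s
  · rw [Set.indicator_of_mem (Set.mem_Ioi.2 hs0)]
    have hmem (θ : ℝ) : Complex.polarCoord.symm (s, θ) ∈ ball (0 : ℂ) R ↔ s < R := by
      rw [mem_ball_zero_iff, Complex.norm_polarCoord_symm, abs_of_pos hs0]
    by_cases hsR : s < R
    · rw [Set.indicator_of_mem (Set.mem_Ioo.2 ⟨hs0, hsR⟩),
        lintegral_const_mul' _ _ ENNReal.ofReal_ne_top]
      simp only [Set.indicator_of_mem ((hmem _).2 hsR)]
    · rw [Set.indicator_of_notMem fun h ↦ hsR h.2]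
      simp only [Set.indicator_of_notMem (mt (hmem _).1 hsR), mul_zero, lintegral_zero]
  · rw [Set.indicator_of_notMem (Set.notMem_Ioi.2 (not_lt.1 hs0)), Set.indicator_of_notMem fun h ↦ hs0 h.1]

/-- The area mean value inequality for the square of the norm of a holomorphic function. -/
lemma volume_ball_mul_enorm_sq_le_lintegral {h : ℂ → ℂ} {R : ℝ}
    (hh : DifferentiableOn ℂ h (ball 0 R)) :
    volume (ball (0 : ℂ) R) * ‖h 0‖ₑ ^ 2 ≤ ∫⁻ w in ball 0 R, ‖h w‖ₑ ^ 2 := by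
  -- Nothing is known about `h` off the ball, so only the indicator is measurable.
  have hm : Measurable ((ball 0 R).indicator fun w ↦ ‖h w‖ₑ ^ 2) := by
    classical
    have : Measurable ((ball 0 R).indicator h) := by
      rw [← Set.piecewise_eq_indicator]
      exact hh.continuousOn.measurable_piecewise continuousOn_const measurableSet_ball
    convert (this.enorm.pow_const 2) using 1
    ext w
    by_cases hw : w ∈ ball 0 R <;> simp [hw]
  have hc := lintegral_ball_zero_eq_polar R (φ := fun _ ↦ ‖h 0‖ₑ ^ 2)
    (measurable_const.indicator measurableSet_ball)
  rw [setLIntegral_const, mul_comm] at hc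
  rw [hc, lintegral_ball_zero_eq_polar R hm]
  refine setLIntegral_mono' measurableSet_Ioo fun s hs ↦ ?_
  refine mul_le_mul_right ?_ _
  refine le_trans (le_of_eq ?_) (two_pi_mul_enorm_sq_le_lintegral_circle hs.1 hs.2 hh)
  rw [setLIntegral_const, Real.volume_Ioo, mul_comm]
  congr 2
  ring

/-! ### The disc model and integration over hyperbolic discs. -/

/-- The inverse of the Cayley transform sending `z` to `0`: it maps the unit disc onto the upper
half-plane and `0` to `z`. -/
noncomputable def invCayley (z : ℍ) (ζ : ℂ) : ℂ := (z - conj (z : ℂ) * ζ) / (1 - ζ)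

lemma one_sub_ne_zero_of_norm_lt_one {ζ : ℂ} (h : ‖ζ‖ < 1) : 1 - ζ ≠ 0 := by
  rintro h0
  rw [← sub_eq_zero.1 h0] at h
  simp at h

lemma sub_conj_eq (z : ℍ) : (z : ℂ) - conj (z : ℂ) = 2 * z.im * Complex.I := by
  rw [Complex.sub_conj]
  push_cast
  rfl

lemma invCayley_zero (z : ℍ) : invCayley z 0 = z := by simp [invCayley]

lemma hasDerivAt_invCayley (z : ℍ) {ζ : ℂ} (h : ‖ζ‖ < 1) :
    HasDerivAt (invCayley z) (2 * z.im * Complex.I / (1 - ζ) ^ 2) ζ := by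
  have h1 := one_sub_ne_zero_of_norm_lt_one h
  have := (((hasDerivAt_id ζ).const_mul (conj (z : ℂ))).const_sub (z : ℂ)).div
    ((hasDerivAt_id ζ).const_sub 1) h1
  refine this.congr_deriv ?_
  rw [← sub_conj_eq]
  simp only [id]
  congr 1
  ring

lemma invCayley_injOn (z : ℍ) : Set.InjOn (invCayley z) (ball 0 1) := by
  intro ζ hζ ξ hξ h
  have h1 := one_sub_ne_zero_of_norm_lt_one (mem_ball_zero_iff.1 hζ)
  have h2 := one_sub_ne_zero_of_norm_lt_one (mem_ball_zero_iff.1 hξ)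
  rw [invCayley, invCayley, div_eq_div_iff h1 h2] at h
  have h3 : ((z : ℂ) - conj (z : ℂ)) * (ζ - ξ) = 0 := by linear_combination h
  rw [sub_conj_eq] at h3
  simpa [z.im_ne_zero, sub_eq_zero] using h3

lemma im_invCayley (z : ℍ) {ζ : ℂ} (h : ‖ζ‖ < 1) :
    (invCayley z ζ).im = z.im * (1 - ‖ζ‖ ^ 2) / ‖1 - ζ‖ ^ 2 := by
  have h1 := one_sub_ne_zero_of_norm_lt_one h
  have h2 : Complex.normSq (1 - ζ) ≠ 0 := by simpa using h1
  rw [invCayley, Complex.div_im, ← Complex.normSq_eq_norm_sq, ← Complex.normSq_eq_norm_sq]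
  field_simp
  simp [Complex.normSq_apply]
  ring

lemma im_invCayley_pos (z : ℍ) {ζ : ℂ} (h : ‖ζ‖ < 1) : 0 < (invCayley z ζ).im := by
  rw [im_invCayley z h]
  have h1 := one_sub_ne_zero_of_norm_lt_one h
  have : 0 < 1 - ‖ζ‖ ^ 2 := by nlinarith [norm_nonneg ζ]
  have := z.im_pos
  positivity

lemma u_invCayley (z : ℍ) {ζ : ℂ} (h : ‖ζ‖ < 1) :
    u z ⟨invCayley z ζ, im_invCayley_pos z h⟩ = (1 + ‖ζ‖ ^ 2) / (1 - ‖ζ‖ ^ 2) := by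
  have h1 := one_sub_ne_zero_of_norm_lt_one h
  have h3 : 1 - ‖ζ‖ ^ 2 ≠ 0 := by nlinarith [norm_nonneg ζ]
  have h4 : ‖1 - ζ‖ ≠ 0 := norm_ne_zero_iff.2 h1
  have hsub : (z : ℂ) - invCayley z ζ = - (2 * z.im * Complex.I * ζ / (1 - ζ)) := by
    rw [← sub_conj_eq, invCayley]
    field_simp
    ring
  have him : (⟨invCayley z ζ, im_invCayley_pos z h⟩ : ℍ).im = z.im * (1 - ‖ζ‖ ^ 2) / ‖1 - ζ‖ ^ 2 :=
    im_invCayley z h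
  have hz := z.im_ne_zero
  rw [u, cosh_dist, him, dist_eq_norm]
  change 1 + ‖(z : ℂ) - invCayley z ζ‖ ^ 2 / _ = _
  rw [hsub, norm_neg, norm_div, norm_mul, norm_mul, norm_mul, Complex.norm_I, Complex.norm_real,
    Real.norm_of_nonneg z.im_pos.le, Complex.norm_ofNat]
  field_simp
  ring

lemma measurableSet_setOf_u_le (z : ℍ) (a : ℝ) : MeasurableSet {w | u z w ≤ a} := by
  refine (isClosed_le ?_ continuous_const).measurableSet
  unfold u
  fun_prop

/-- Integration over `ℍ` of a function multiplied by `y ^ 2` is integration for Lebesgue measure. -/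
lemma setLIntegral_mul_im_sq (s : Set ℍ) (hs : MeasurableSet s) {φ : ℂ → ℝ≥0∞}
    (hφ : Measurable fun w : ℍ ↦ φ w) :
    ∫⁻ w in s, φ w * ENNReal.ofReal (w.im ^ 2) = ∫⁻ w in (↑) '' s, φ w := by
  have hmp : MeasurePreserving UpperHalfPlane.coe (volume.comap UpperHalfPlane.coe)
      (volume.restrict (.range UpperHalfPlane.coe)) :=
    ⟨measurable_coe, by rw [measurableEmbedding_coe.map_comap]⟩
  have hd : Measurable fun z : ℍ ↦ (((1 / NNReal.mk z.im z.im_pos.le : NNReal) ^ 2 : NNReal) : ℝ≥0∞) := by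
    refine Measurable.coe_nnreal_ennreal (Measurable.pow_const (Measurable.const_div ?_ _) _)
    exact (continuous_im.subtype_mk _).measurable
  have hw := setLIntegral_withDensity_eq_setLIntegral_mul (volume.comap UpperHalfPlane.coe) hd
    (hφ.mul (continuous_im.measurable.pow_const 2).ennreal_ofReal) hs
  simp only [Pi.mul_apply] at hw
  rw [volume_def, hw,
    ← Set.inter_eq_self_of_subset_left (Set.image_subset_range UpperHalfPlane.coe s),
    ← Measure.restrict_restrict', ← hmp.setLIntegral_comp_emb measurableEmbedding_coe]
  · refine lintegral_congr fun w ↦ ?_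
    have : ((((1 / NNReal.mk w.im w.im_pos.le : NNReal) ^ 2 : NNReal) : ℝ≥0∞)) * ENNReal.ofReal (w.im ^ 2) = 1 := by
      rw [← ENNReal.ofReal_coe_nnreal, ← ENNReal.ofReal_mul (NNReal.coe_nonneg _)]
      simp [w.im_ne_zero]
    rw [mul_left_comm, this, mul_one]
  · exact measurableEmbedding_coe.measurableSet_range

lemma abs_det_restrictScalars_toSpanSingleton (c : ℂ) :
    |((ContinuousLinearMap.toSpanSingleton ℂ c).restrictScalars ℝ).det| = ‖c‖ ^ 2 := by
  simp [ContinuousLinearMap.det, LinearMap.det_restrictScalars, Algebra.norm_complex_apply,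
    Complex.normSq_eq_norm_sq]

/-- Mean value inequality on a hyperbolic disc for weight 2 forms. -/
lemma enorm_sq_mul_im_sq_le_lintegral {f : ℍ → ℂ} (hf : MDiff f) (z : ℍ) {a : ℝ} (ha : 1 < a) :
    ENNReal.ofReal (4 * π * ((a - 1) / (a + 1)) * (z.im ^ 2 * ‖f z‖ ^ 2)) ≤
      ∫⁻ w in {w | u z w ≤ a}, ENNReal.ofReal (w.im ^ 2 * ‖f w‖ ^ 2) := by
  -- The Euclidean radius for which `(1 + ρ²) / (1 - ρ²) = a`.
  set ρ : ℝ := √((a - 1) / (a + 1)) with hρ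
  have hq : 0 < (a - 1) / (a + 1) := div_pos (by linarith) (by linarith)
  have hq1 : (a - 1) / (a + 1) < 1 := by rw [div_lt_one (by linarith)]; linarith
  have hρ2 : ρ ^ 2 = (a - 1) / (a + 1) := Real.sq_sqrt hq.le
  have hρ1 : ρ < 1 := by rw [hρ, Real.sqrt_lt' one_pos]; simpa using hq1
  have hlt {ζ : ℂ} (hζ : ζ ∈ ball (0 : ℂ) ρ) : ‖ζ‖ < 1 := (mem_ball_zero_iff.1 hζ).trans hρ1
  set S : Set ℍ := {w | u z w ≤ a}
  have hS : MeasurableSet S := measurableSet_setOf_u_le z a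
  have hfc : Measurable fun w : ℍ ↦ ‖(f ∘ ofComplex) w‖ₑ ^ 2 := by
    simpa using (hf.continuous.measurable.enorm.pow_const 2)
  have hsub : invCayley z '' ball 0 ρ ⊆ UpperHalfPlane.coe '' S := by
    rintro _ ⟨ζ, hζ, rfl⟩
    refine ⟨⟨invCayley z ζ, im_invCayley_pos z (hlt hζ)⟩, ?_, rfl⟩
    change u _ _ ≤ a
    have h5 : ‖ζ‖ ^ 2 < (a - 1) / (a + 1) := by
      rw [← hρ2]
      exact pow_lt_pow_left₀ (mem_ball_zero_iff.1 hζ) (norm_nonneg _) two_ne_zero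
    rw [lt_div_iff₀ (by linarith)] at h5
    have h6 : 0 < 1 - ‖ζ‖ ^ 2 := by nlinarith [norm_nonneg ζ, hlt hζ]
    rw [u_invCayley z (hlt hζ), div_le_iff₀ h6]
    nlinarith
  -- The pullback of `f(w) dw`; weight 2 makes the Jacobian exactly the square of the extra factor.
  set h : ℂ → ℂ := fun ζ ↦ (f ∘ ofComplex) (invCayley z ζ) * (2 * z.im * Complex.I / (1 - ζ) ^ 2)
  have hh : DifferentiableOn ℂ h (ball 0 ρ) := by
    refine DifferentiableOn.mul ?_ ?_
    · exact (UpperHalfPlane.mdifferentiable_iff.1 hf).comp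
        (fun ζ hζ ↦ (hasDerivAt_invCayley z (hlt hζ)).differentiableAt.differentiableWithinAt)
        fun ζ hζ ↦ im_invCayley_pos z (hlt hζ)
    · refine (differentiableOn_const _).div (by fun_prop) fun ζ hζ ↦ ?_
      exact pow_ne_zero _ (one_sub_ne_zero_of_norm_lt_one (hlt hζ))
  have hmean := volume_ball_mul_enorm_sq_le_lintegral hh
  have hcv := lintegral_image_eq_lintegral_abs_det_fderiv_mul volume
    (measurableSet_ball (x := (0 : ℂ)) (ε := ρ))
    (fun ζ hζ ↦ ((hasDerivAt_invCayley z (hlt hζ)).hasFDerivAt.restrictScalars ℝ).hasFDerivWithinAt)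
    ((invCayley_injOn z).mono (ball_subset_ball hρ1.le))
    (fun w ↦ ‖(f ∘ ofComplex) w‖ₑ ^ 2)
  calc _ = volume (ball (0 : ℂ) ρ) * ‖h 0‖ₑ ^ 2 := by
        rw [Complex.volume_ball, ← enorm_pow, ← ofReal_norm, ← ENNReal.ofReal_pow (Real.sqrt_nonneg _),
          ← ENNReal.ofReal_coe_nnreal, ← ENNReal.ofReal_mul (by positivity),
          ← ENNReal.ofReal_mul (by positivity), hρ2]
        congr 1
        simp [h, invCayley_zero, ofComplex_apply, mul_pow]
        ring
    _ ≤ ∫⁻ ζ in ball 0 ρ, ‖h ζ‖ₑ ^ 2 := hmean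
    _ = ∫⁻ w in invCayley z '' ball 0 ρ, ‖(f ∘ ofComplex) w‖ₑ ^ 2 := by
        rw [hcv]
        refine lintegral_congr fun ζ ↦ ?_
        simp only [h, enorm_mul, mul_pow]
        rw [mul_comm]
        congr 1
        rw [abs_det_restrictScalars_toSpanSingleton, ENNReal.ofReal_pow (norm_nonneg _),
          ofReal_norm]
    _ ≤ ∫⁻ w in UpperHalfPlane.coe '' S, ‖(f ∘ ofComplex) w‖ₑ ^ 2 := lintegral_mono_set hsub
    _ = _ := by
        rw [← setLIntegral_mul_im_sq S hS hfc]
        refine lintegral_congr fun w ↦ ?_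
        rw [← enorm_pow, ← ofReal_norm, ← ENNReal.ofReal_mul (norm_nonneg _)]
        simp [ofComplex_apply, mul_comm]

/-! ### Group action, counting of translates and unfolding. -/

lemma toPGL_smul (γ : SL(2, ℝ)) (w : ℍ) : SpecialLinearGroup.toPGL γ • w = γ • w := by
  rfl

lemma toPGL_neg (γ : SL(2, ℝ)) :
    SpecialLinearGroup.toPGL (-γ) = SpecialLinearGroup.toPGL γ := by
  have : SpecialLinearGroup.toPGL (-1 : SL(2, ℝ)) = 1 := by
    rw [← MonoidHom.mem_ker, SpecialLinearGroup.toPGL_ker, Subgroup.mem_center_iff]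
    simp
  rw [← neg_one_mul, map_mul, this, one_mul]

lemma ne_neg_self (γ : SL(2, ℝ)) : γ ≠ -γ := by
  intro h
  have h1 := congrArg (fun g : SL(2, ℝ) ↦ (g : Matrix (Fin 2) (Fin 2) ℝ)) h
  simp only [SpecialLinearGroup.coe_neg] at h1
  have h2 (i k : Fin 2) : γ i k = 0 := by
    have : γ i k = -γ i k := congrFun (congrFun h1 i) k
    linarith
  have := γ.det_coe
  rw [det_fin_two, h2 0 0, h2 0 1] at this
  simp at this

instance smulInvariantMeasure_projImage (Γ : Subgroup SL(2, ℝ)) :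
    SMulInvariantMeasure (projImage Γ) ℍ volume where
  measure_preimage_smul := by
    rintro ⟨_, γ, hγ, rfl⟩ s hs
    exact measure_preimage_smul_of_nullMeasurableSet hs.nullMeasurableSet (SpecialLinearGroup.toGL γ)

instance measurableConstSMul_projImage (Γ : Subgroup SL(2, ℝ)) :
    MeasurableConstSMul (projImage Γ) ℍ where
  measurable_const_smul := by
    rintro ⟨_, γ, hγ, rfl⟩
    exact (continuous_const_smul γ).measurable

lemma countable_projImage (Γ : Subgroup SL(2, ℝ)) [DiscreteTopology Γ] :
    Countable (projImage Γ) := by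
  have : Countable Γ := by
    have : SecondCountableTopology (Matrix (Fin 2) (Fin 2) ℝ) :=
      inferInstanceAs (SecondCountableTopology (Fin 2 → Fin 2 → ℝ))
    have : SecondCountableTopology SL(2, ℝ) :=
      SpecialLinearGroup.isClosedEmbedding_val.isEmbedding.secondCountableTopology
    exact TopologicalSpace.separableSpace_iff_countable.1 inferInstance
  exact Set.countable_coe_iff.2 (Set.Countable.image (s := (Γ : Set SL(2, ℝ)))
    (Set.countable_coe_iff.1 this) SpecialLinearGroup.toPGL)

lemma finite_setOf_u_smul_le (Γ : Subgroup SL(2, ℝ)) [DiscreteTopology Γ] (z : ℍ) (b : ℝ) :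
    {γ : SL(2, ℝ) | γ ∈ Γ ∧ u z (γ • z) ≤ b}.Finite := by
  have hK : IsCompact (closedBall z b) := isCompact_closedBall z b
  refine ((Subgroup.properlyDiscontinuousSMul_iff Γ).1 inferInstance
    (isCompact_singleton (x := z)) hK).subset fun γ ⟨hγ, hu⟩ ↦ ⟨hγ, γ • z, ?_, ?_⟩
  · exact Set.smul_mem_smul_set (Set.mem_singleton z)
  · rw [mem_closedBall, dist_comm]
    -- The crude chain `d ≤ sinh d < cosh d ≤ b` suffices for finiteness.
    exact ((Real.self_le_sinh_iff.2 dist_nonneg).trans (Real.sinh_lt_cosh _).le).trans hu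

/-- The triangle inequality and the addition formula for `cosh`, with AM-GM on both products and
`sinh² = cosh² - 1`. -/
lemma u_le_of_u_le_of_u_le {x y z : ℍ} {a : ℝ} (h₁ : u x y ≤ a) (h₂ : u y z ≤ a) :
    u x z ≤ 2 * a ^ 2 - 1 := by
  unfold u at *
  have h3 : Real.cosh (dist x z) ≤ Real.cosh (dist x y + dist y z) := by
    rw [Real.cosh_le_cosh, abs_of_nonneg dist_nonneg, abs_of_nonneg (by positivity)]
    exact dist_triangle x y z
  rw [Real.cosh_add] at h3
  have e1 := Real.cosh_sq (dist x y)
  have e2 := Real.cosh_sq (dist y z)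
  have p1 := Real.cosh_pos (dist x y)
  have p2 := Real.cosh_pos (dist y z)
  nlinarith [sq_nonneg (Real.sinh (dist x y) - Real.sinh (dist y z)),
    sq_nonneg (Real.cosh (dist x y) - Real.cosh (dist y z))]

/-- The number of translates of a point in a hyperbolic disc is bounded in terms of the counting
function at the centre. -/
lemma finite_and_genericStabCard_mul_ncard_le (Γ : Subgroup SL(2, ℝ)) [DiscreteTopology Γ]
    (z w : ℍ) (a : ℝ) :
    {p : projImage Γ | u z (p • w) ≤ a}.Finite ∧
      genericStabCard Γ * {p : projImage Γ | u z (p • w) ≤ a}.ncard ≤ N Γ z (2 * a ^ 2 - 1) := by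
  set T := {p : projImage Γ | u z (p • w) ≤ a}
  have hG := finite_setOf_u_smul_le Γ z (2 * a ^ 2 - 1)
  rw [N]
  set G := {γ : SL(2, ℝ) | γ ∈ Γ ∧ u z (γ • z) ≤ 2 * a ^ 2 - 1}
  rcases T.eq_empty_or_nonempty with hT | ⟨q, hq⟩
  · simp [hT]
  choose l hlΓ hl using fun p : projImage Γ ↦ Subgroup.mem_map.1 p.2
  have hsmul (p : projImage Γ) (x : ℍ) : p • x = l p • x := by
    rw [← toPGL_smul, hl]
    rfl
  -- Comparing with one fixed translate `q • w` turns translates of `w` into elements moving `z` a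
  -- bounded distance.
  let j (p : projImage Γ) : SL(2, ℝ) := l p * (l q)⁻¹
  have hjT : j '' T ⊆ G := by
    rintro _ ⟨p, hp, rfl⟩
    refine ⟨Γ.mul_mem (hlΓ p) (Γ.inv_mem (hlΓ q)), u_le_of_u_le_of_u_le (y := l p • w) ?_ ?_⟩
    · rw [← hsmul]
      exact hp
    · have : dist (l p • w) (j p • z) = dist z (q • w) := by
        rw [mul_smul, dist_smul, ← dist_smul (l q), smul_inv_smul, dist_comm, hsmul]
      rw [u, this]
      exact hq
  have hpgl (p : projImage Γ) :
      SpecialLinearGroup.toPGL (j p) = (p : PGL(2, ℝ)) * (q : PGL(2, ℝ))⁻¹ := by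
    rw [map_mul, map_inv, hl, hl]
  have hinj : Function.Injective j := fun p p' h ↦ by
    have := hpgl p
    rw [h, hpgl p'] at this
    exact (Subtype.ext (mul_right_cancel this)).symm
  refine ⟨(hG.subset hjT).of_finite_image hinj.injOn, ?_⟩
  rw [genericStabCard]
  split_ifs with hneg
  -- When `-1 ∈ Γ`, both lifts `±j p` are counted, which supplies the factor 2.
  · have hjT' : (fun p ↦ -j p) '' T ⊆ G := by
      rintro _ ⟨p, hp, rfl⟩
      have := hjT ⟨p, hp, rfl⟩
      refine ⟨?_, ?_⟩
      · have h := Γ.mul_mem hneg this.1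
        rwa [neg_one_mul] at h
      · have h := this.2
        rwa [← toPGL_smul, ← toPGL_neg, toPGL_smul] at h
    have hdisj : Disjoint (j '' T) ((fun p ↦ -j p) '' T) := by
      rw [Set.disjoint_left]
      rintro _ ⟨p, -, rfl⟩ ⟨p', -, h⟩
      have h1 := hpgl p
      rw [← h, toPGL_neg, hpgl p'] at h1
      obtain rfl : p' = p := Subtype.ext (mul_right_cancel h1)
      exact ne_neg_self (j p') h.symm
    calc 2 * T.ncard = (j '' T).ncard + ((fun p ↦ -j p) '' T).ncard := by
          rw [Set.ncard_image_of_injective _ hinj,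
            Set.ncard_image_of_injective _ fun p p' h ↦ hinj (neg_injective h), two_mul]
      _ = (j '' T ∪ (fun p ↦ -j p) '' T).ncard :=
          (Set.ncard_union_eq hdisj (hG.subset hjT) (hG.subset hjT')).symm
      _ ≤ G.ncard := Set.ncard_le_ncard (Set.union_subset hjT hjT') hG
  · rw [one_mul, ← Set.ncard_image_of_injective _ hinj]
    exact Set.ncard_le_ncard hjT hG

/-- Integrating an invariant function over a hyperbolic disc and over a fundamental domain. -/
lemma genericStabCard_mul_lintegral_le (Γ : Subgroup SL(2, ℝ)) [DiscreteTopology Γ]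
    {D : Set ℍ} (hD : IsFundDomain Γ D) {φ : ℍ → ℝ≥0∞} (hφ : Measurable φ)
    (hinv : ∀ (p : projImage Γ) (w : ℍ), φ (p • w) = φ w) (z : ℍ) (a : ℝ) :
    genericStabCard Γ * ∫⁻ w in {w | u z w ≤ a}, φ w ≤ N Γ z (2 * a ^ 2 - 1) * ∫⁻ w in D, φ w := by
  have := countable_projImage Γ
  set S : Set ℍ := {w | u z w ≤ a}
  have hS : MeasurableSet S := measurableSet_setOf_u_le z a
  have hcount (w : ℍ) : ∑' p : projImage Γ, S.indicator φ (p • w) =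
      {p : projImage Γ | u z (p • w) ≤ a}.ncard * φ w := by
    have h1 (p : projImage Γ) : S.indicator φ (p • w) =
        {p : projImage Γ | u z (p • w) ≤ a}.indicator (fun _ ↦ φ w) p := by
      by_cases hp : u z (p • w) ≤ a
      · rw [Set.indicator_of_mem (show p • w ∈ S from hp),
          Set.indicator_of_mem (show p ∈ {p : projImage Γ | u z (p • w) ≤ a} from hp), hinv]
      · rw [Set.indicator_of_notMem (show p • w ∉ S from hp),
          Set.indicator_of_notMem (show p ∉ {p : projImage Γ | u z (p • w) ≤ a} from hp)]
    simp only [h1]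
    rw [← tsum_subtype, ENNReal.tsum_set_const,
      ← (finite_and_genericStabCard_mul_ncard_le Γ z w a).1.cast_ncard_eq]
    simp
  calc (genericStabCard Γ : ℝ≥0∞) * ∫⁻ w in S, φ w
      = genericStabCard Γ * ∫⁻ w in D, ∑' p : projImage Γ, S.indicator φ (p • w) := by
        rw [← lintegral_indicator hS, hD.lintegral_eq_tsum'', lintegral_tsum]
        exact fun p ↦ ((hφ.indicator hS).comp (measurable_const_smul p)).aemeasurable
    _ = ∫⁻ w in D, genericStabCard Γ * ({p : projImage Γ | u z (p • w) ≤ a}.ncard * φ w) := by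
        rw [lintegral_const_mul' _ _ (ENNReal.natCast_ne_top _)]
        simp only [hcount]
    _ ≤ ∫⁻ w in D, N Γ z (2 * a ^ 2 - 1) * φ w := by
        refine lintegral_mono fun w ↦ ?_
        rw [← mul_assoc]
        gcongr
        exact_mod_cast (finite_and_genericStabCard_mul_ncard_le Γ z w a).2
    _ = _ := lintegral_const_mul' _ _ (ENNReal.natCast_ne_top _)

/-! ### Petersson norms and orthonormal bases. -/

lemma petersson_two_self (f : ℍ → ℂ) (w : ℍ) :
    petersson 2 f f w = ((w.im ^ 2 * ‖f w‖ ^ 2 : ℝ) : ℂ) := by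
  rw [petersson, ← Complex.normSq_eq_conj_mul_self, Complex.normSq_eq_norm_sq]
  push_cast
  rw [mul_comm]
  norm_cast

lemma continuous_cuspForm {Γ : Subgroup SL(2, ℝ)} (f : CuspForms₂ Γ) : Continuous f :=
  (CuspFormClass.holo f).continuous

lemma im_sq_mul_norm_sq_smul {Γ : Subgroup SL(2, ℝ)} (f : CuspForms₂ Γ) (p : projImage Γ) (w : ℍ) :
    (p • w).im ^ 2 * ‖f (p • w)‖ ^ 2 = w.im ^ 2 * ‖f w‖ ^ 2 := by
  obtain ⟨_, γ, hγ, rfl⟩ := p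
  have h := SlashInvariantFormClass.petersson_smul (k := 2) (f := f) (f' := f) (τ := w)
    (Γ := Γ.map SpecialLinearGroup.toGL) (Subgroup.mem_map_of_mem SpecialLinearGroup.toGL hγ)
  rw [petersson_two_self, petersson_two_self] at h
  exact Complex.ofReal_injective h

lemma genericStabCard_pos (Γ : Subgroup SL(2, ℝ)) : 0 < genericStabCard Γ := by
  unfold genericStabCard
  split_ifs <;> norm_num

/-- Pointwise bound for a square-integrable cusp form of weight 2. -/
lemma im_sq_mul_norm_sq_le {Γ : Subgroup SL(2, ℝ)} [DiscreteTopology Γ] {D : Set ℍ}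
    (hD : IsFundDomain Γ D) (f : CuspForms₂ Γ) (hf : IntegrableOn (petersson 2 f f) D)
    (z : ℍ) {a : ℝ} (ha : 1 < a) :
    4 * π * ((a - 1) / (a + 1)) * (z.im ^ 2 * ‖f z‖ ^ 2) ≤
      N Γ z (2 * a ^ 2 - 1) * (peterssonInner Γ D f f).re := by
  have hint : IntegrableOn (fun w : ℍ ↦ w.im ^ 2 * ‖f w‖ ^ 2) D := by
    refine hf.re.congr (.of_forall fun w ↦ ?_)
    simp only [petersson_two_self, RCLike.re_to_complex, Complex.ofReal_re]
  have hre : (peterssonInner Γ D f f).re =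
      (genericStabCard Γ : ℝ)⁻¹ * ∫ w in D, w.im ^ 2 * ‖f w‖ ^ 2 := by
    rw [peterssonInner, quotientIntegral]
    simp only [petersson_two_self]
    rw [integral_complex_ofReal, ← Complex.ofReal_natCast, ← Complex.ofReal_inv,
      Complex.re_ofReal_mul, Complex.ofReal_re]
  have hm : Measurable fun w : ℍ ↦ ENNReal.ofReal (w.im ^ 2 * ‖f w‖ ^ 2) := by
    have := continuous_cuspForm f
    have : Continuous fun w : ℍ ↦ w.im ^ 2 * ‖f w‖ ^ 2 := by fun_prop
    exact this.measurable.ennreal_ofReal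
  have h1 := genericStabCard_mul_lintegral_le Γ hD hm
    (fun p w ↦ by rw [im_sq_mul_norm_sq_smul]) z a
  have h2 := enorm_sq_mul_im_sq_le_lintegral (CuspFormClass.holo f) z ha
  have hI : 0 ≤ ∫ w in D, w.im ^ 2 * ‖f w‖ ^ 2 := integral_nonneg fun w ↦ by positivity
  rw [← ofReal_integral_eq_lintegral_ofReal hint (.of_forall fun w ↦ by positivity)] at h1
  have h3 := (mul_le_mul_right h2 (genericStabCard Γ : ℝ≥0∞)).trans h1
  rw [← ENNReal.ofReal_natCast, ← ENNReal.ofReal_natCast,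
    ← ENNReal.ofReal_mul (Nat.cast_nonneg _), ← ENNReal.ofReal_mul (Nat.cast_nonneg _),
    ENNReal.ofReal_le_ofReal_iff (by positivity)] at h3
  have hg : (0 : ℝ) < genericStabCard Γ := by exact_mod_cast genericStabCard_pos Γ
  rw [hre, mul_left_comm (N Γ z _ : ℝ), ← div_eq_inv_mul, le_div_iff₀' hg]
  exact h3

lemma norm_petersson_two_le (f g : ℍ → ℂ) (w : ℍ) :
    ‖petersson 2 f g w‖ ≤ ‖petersson 2 f f w‖ + ‖petersson 2 g g w‖ := by
  simp only [petersson, norm_mul, Complex.norm_conj]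
  rw [← add_mul]
  gcongr
  nlinarith [sq_nonneg (‖f w‖ - ‖g w‖), mul_nonneg (norm_nonneg (f w)) (norm_nonneg (g w))]

lemma IsOrthonormalBasis.integrableOn_petersson {Γ : Subgroup SL(2, ℝ)} {D : Set ℍ}
    {B : Set (CuspForms₂ Γ)} (hB : IsOrthonormalBasis Γ D B) (f g : B) :
    IntegrableOn (petersson 2 f.1 g.1) D := by
  have hself (f : B) : IntegrableOn (petersson 2 f.1 f.1) D := by
    -- The integral of a non-integrable function is 0 by convention, contradicting norm 1.
    by_contra h
    have h1 := hB.normalized f.1 f.2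
    rw [peterssonInner, quotientIntegral, integral_undef h] at h1
    simp at h1
  refine Integrable.mono' ((hself f).norm.add (hself g).norm) ?_
    (.of_forall fun w ↦ norm_petersson_two_le _ _ w)
  exact (petersson_continuous 2 (continuous_cuspForm _) (continuous_cuspForm _)).aestronglyMeasurable

lemma sum_smul_apply {Γ : Subgroup SL(2, ℝ)} {ι : Type*} (s : Finset ι) (c : ι → ℂ)
    (f : ι → CuspForms₂ Γ) (w : ℍ) : (∑ i ∈ s, c i • f i) w = ∑ i ∈ s, c i * f i w := by
  classical
  induction s using Finset.induction_on with
  | empty => simp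
  | insert i s hi ih => rw [Finset.sum_insert hi, Finset.sum_insert hi, ← ih]; rfl

/-- The Petersson norm of a linear combination of members of an orthonormal basis. -/
lemma IsOrthonormalBasis.integrableOn_and_peterssonInner_sum {Γ : Subgroup SL(2, ℝ)} {D : Set ℍ}
    {B : Set (CuspForms₂ Γ)} (hB : IsOrthonormalBasis Γ D B) (s : Finset B) (c : B → ℂ) :
    IntegrableOn (petersson 2 (∑ i ∈ s, c i • i.1 : CuspForms₂ Γ)
      (∑ i ∈ s, c i • i.1 : CuspForms₂ Γ)) D ∧
    peterssonInner Γ D (∑ i ∈ s, c i • i.1) (∑ i ∈ s, c i • i.1) =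
      ((∑ i ∈ s, ‖c i‖ ^ 2 : ℝ) : ℂ) := by
  classical
  have hexp : petersson 2 (∑ i ∈ s, c i • i.1 : CuspForms₂ Γ) (∑ i ∈ s, c i • i.1 : CuspForms₂ Γ) =
      fun w ↦ ∑ i ∈ s, ∑ j ∈ s, conj (c i) * c j * petersson 2 i.1 j.1 w := by
    ext w
    simp only [petersson, sum_smul_apply, map_sum, map_mul]
    rw [Finset.sum_mul_sum, Finset.sum_mul]
    simp only [Finset.sum_mul]
    exact Finset.sum_congr rfl fun i _ ↦ Finset.sum_congr rfl fun j _ ↦ by ring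
  have hij (i j : B) : Integrable (fun w ↦ conj (c i) * c j * petersson 2 i.1 j.1 w)
      (volume.restrict D) := (hB.integrableOn_petersson i j).const_mul _
  have hi (i : B) : Integrable (fun w ↦ ∑ j ∈ s, conj (c i) * c j * petersson 2 i.1 j.1 w)
      (volume.restrict D) := integrable_finsetSum _ fun j _ ↦ hij i j
  have horth (i j : B) : peterssonInner Γ D i.1 j.1 = if i = j then 1 else 0 := by
    split_ifs with h
    · rw [h, hB.normalized _ j.2]
    · exact hB.orthogonal _ i.2 _ j.2 fun h' ↦ h (Subtype.ext h')
  refine ⟨?_, ?_⟩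
  · rw [hexp]
    exact integrable_finsetSum _ fun i _ ↦ hi i
  · calc _ = ∑ i ∈ s, ∑ j ∈ s, conj (c i) * c j * peterssonInner Γ D i.1 j.1 := by
          simp only [peterssonInner, quotientIntegral]
          rw [hexp, integral_finsetSum _ fun i _ ↦ hi i, Finset.mul_sum]
          refine Finset.sum_congr rfl fun i _ ↦ ?_
          rw [integral_finsetSum _ fun j _ ↦ hij i j, Finset.mul_sum]
          refine Finset.sum_congr rfl fun j _ ↦ ?_
          rw [integral_const_mul]
          ring
      _ = _ := by
          push_cast
          refine Finset.sum_congr rfl fun i hi ↦ ?_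
          simp only [horth, mul_ite, mul_one, mul_zero, Finset.sum_ite_eq, hi, if_true]
          rw [← Complex.normSq_eq_conj_mul_self, Complex.normSq_eq_norm_sq]
          push_cast
          rfl

/-- Finite partial sums of the series defining `bergmanF`. -/
lemma IsOrthonormalBasis.sum_bergmanTerm_le {Γ : Subgroup SL(2, ℝ)} [DiscreteTopology Γ]
    {D : Set ℍ} (hD : IsFundDomain Γ D) {B : Set (CuspForms₂ Γ)} (hB : IsOrthonormalBasis Γ D B)
    (s : Finset B) (z : ℍ) {a : ℝ} (ha : 1 < a) :
    4 * π * ((a - 1) / (a + 1)) * ∑ f ∈ s, bergmanTerm B z f ≤ N Γ z (2 * a ^ 2 - 1) := by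
  set S : ℝ := ∑ f ∈ s, ‖f.1 z‖ ^ 2
  have hS : ∑ f ∈ s, bergmanTerm B z f = z.im ^ 2 * S := by
    simp only [bergmanTerm, S, Finset.mul_sum]
  -- With these coefficients the value at `z` and the squared norm are both `S`, so one factor `S`
  -- cancels below.
  obtain ⟨hint, hinner⟩ := hB.integrableOn_and_peterssonInner_sum s fun f ↦ conj (f.1 z)
  have h := im_sq_mul_norm_sq_le hD _ hint z ha
  have hval : (∑ f ∈ s, conj (f.1 z) • f.1 : CuspForms₂ Γ) z = (S : ℂ) := by
    rw [sum_smul_apply]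
    simp only [← Complex.normSq_eq_conj_mul_self, Complex.normSq_eq_norm_sq, S]
    push_cast
    rfl
  have hS0 : 0 ≤ S := Finset.sum_nonneg fun _ _ ↦ by positivity
  rw [hinner, hval, Complex.ofReal_re, Complex.norm_real, Real.norm_of_nonneg hS0] at h
  simp only [Complex.norm_conj] at h
  rw [hS]
  rcases hS0.eq_or_lt with h0 | h0
  · rw [← h0]
    simp
  · refine le_of_mul_le_mul_right ?_ h0
    calc _ = 4 * π * ((a - 1) / (a + 1)) * (z.im ^ 2 * S ^ 2) := by ring
      _ ≤ _ := h

/-! ### The logarithm and the final bound. -/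

/-- This is `t ≤ sinh t` at `t = log s / 2`, squared. -/
lemma log_sq_mul_le {s : ℝ} (hs : 1 < s) : Real.log s ^ 2 * s ≤ (s - 1) ^ 2 := by
  have hs0 : 0 < s := by linarith
  have hlog := Real.log_pos hs
  have h1 := (Real.self_le_sinh_iff (x := Real.log s / 2)).2 (by linarith)
  have h2 : Real.sinh (Real.log s / 2) ^ 2 = (s - 1) ^ 2 / (4 * s) := by
    have h3 := Real.cosh_sq (Real.log s / 2)
    have h4 := Real.cosh_two_mul (Real.log s / 2)
    rw [mul_div_cancel₀ _ two_ne_zero, Real.cosh_log hs0] at h4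
    have : Real.sinh (Real.log s / 2) ^ 2 = ((s + s⁻¹) / 2 - 1) / 2 := by linarith
    rw [this]
    field_simp
    ring
  have h5 : (Real.log s / 2) ^ 2 ≤ (s - 1) ^ 2 / (4 * s) := by
    rw [← h2]
    gcongr
  rw [le_div_iff₀ (by linarith)] at h5
  linarith

end FuchsianBound

theorem mainTheorem3 (Γ : Subgroup SL(2, ℝ)) (hΓ : FuchsianBound.IsCofiniteFuchsian Γ)
    (D : Set UpperHalfPlane) (hD : FuchsianBound.IsFundDomain Γ D)
    (B : Set (FuchsianBound.CuspForms₂ Γ)) (hB : FuchsianBound.IsOrthonormalBasis Γ D B)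
    (z : UpperHalfPlane) (a : ℝ) (ha : 1 < a) :
    Summable (FuchsianBound.bergmanTerm B z) ∧
    FuchsianBound.bergmanF B z ≤
      (a - 1) * (FuchsianBound.N Γ z (2 * a ^ 2 - 1) : ℝ) /
        (8 * Real.pi * (Real.log ((a + 1) / 2)) ^ 2) := by
  have := hΓ.discrete
  have hlog : 0 < Real.log ((a + 1) / 2) := Real.log_pos (by linarith)
  have hfin (s : Finset B) : ∑ f ∈ s, FuchsianBound.bergmanTerm B z f ≤
      (a - 1) * (FuchsianBound.N Γ z (2 * a ^ 2 - 1) : ℝ) /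
        (8 * Real.pi * (Real.log ((a + 1) / 2)) ^ 2) := by
    have h := hB.sum_bergmanTerm_le hD s z ha
    set S := ∑ f ∈ s, FuchsianBound.bergmanTerm B z f
    have hS : 0 ≤ S := Finset.sum_nonneg fun _ _ ↦ by
      unfold FuchsianBound.bergmanTerm
      positivity
    have hl := FuchsianBound.log_sq_mul_le (s := (a + 1) / 2) (by linarith)
    rw [le_div_iff₀ (by positivity)]
    refine le_trans ?_ (mul_le_mul_of_nonneg_left h (by linarith : 0 ≤ a - 1))
    -- For `s = (a + 1) / 2`, the right side is `(s - 1)² / s`.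
    have hl' : Real.log ((a + 1) / 2) ^ 2 ≤ (a - 1) ^ 2 / (2 * (a + 1)) := by
      rw [le_div_iff₀ (by linarith)]
      nlinarith
    calc _ ≤ S * (8 * Real.pi * ((a - 1) ^ 2 / (2 * (a + 1)))) := by gcongr
      _ = _ := by
        have : a + 1 ≠ 0 := by linarith
        field_simp
        ring
  have hnn (f : B) : 0 ≤ FuchsianBound.bergmanTerm B z f := by
    unfold FuchsianBound.bergmanTerm
    positivity
  exact ⟨summable_of_sum_le hnn hfin, Real.tsum_le_of_sum_le hnn hfin⟩
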